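/- Let $\Sigma$ be a finite alphabet with at least two elements, and let $\Pr$ be the uniform probability measure on $\Sigma^\omega$, i.e. the probability measure on the $\sigma$-algebra generated by the cylinder sets with $\Pr\{w : a_1\cdots a_n \text{ is a prefix of } w\} = |\Sigma|^{-n}$ for all $a_1,\dots,a_n\in\Sigma$. Let $\mathcal U=(Q,\Sigma,\delta,Q_0,F)$ be a Büchi automaton with finite state set $Q$, transition function $\delta: Q\times\Sigma\to 2^Q$, nonempty set $Q_0\subseteq Q$ of initial states and nonempty set $F\subseteq Q$ of final states. An accepting run of $\mathcal U$ for $w=a_1a_2\cdots\in\Sigma^\omega$ is a sequence $q_0q_1\cdots\in Q^\omega$ with $q_0\in Q_0$, $q_{i+1}\in\delta(q_i,a_{i+1})$ for all $i\ge 0$, and $q_i\in F$ for infinitely many $i$; $\mathcal L_\omega(\mathcal U)$ is the set of words in $\Sigma^\omega$ that have at least one accepting run. Assume that $\mathcal U$ is unambiguous (each $w\in\Sigma^\omega$ has at most one accepting run) and strongly connected (every state is reachable from every state). Define $M\in[0,1]^{Q\times Q}$ by $$M_{p,q}=\frac{|\{a\in\Sigma : q\in\delta(p,a)\}|}{|\Sigma|},$$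 and let $\rho(M)$ be its spectral radius, i.e. the maximum of the absolute values of its complex eigenvalues. Then $\rho(M)\le 1$. Moreover, $\rho(M)=1$ if and only if $\Pr(\mathcal L_\omega(\mathcal U))>0$. -/

import Mathlib

open MeasureTheory

/-- A nondeterministic Büchi automaton `(Q, A, δ, Q₀, F)` with state set `Q` and alphabet `A`:
`step` is `δ : Q × A → 2^Q`, `start` is `Q₀` and `accept` is `F`. -/
structure NBA (A Q : Type*) where
  step : Q → A → Set Q
  start : Set Q
  accept : Set Q

namespace NBA

variable {A Q : Type*}

/-- `r` is a run of `U` for the infinite word `w` (letters and states are indexed from `0`). -/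
def IsRun (U : NBA A Q) (w : ℕ → A) (r : ℕ → Q) : Prop :=
  r 0 ∈ U.start ∧ ∀ i, r (i + 1) ∈ U.step (r i) (w i)

/-- `r` is a run of `U` for `w` that visits accepting states infinitely often. -/
def IsAcceptingRun (U : NBA A Q) (w : ℕ → A) (r : ℕ → Q) : Prop :=
  U.IsRun w r ∧ {i | r i ∈ U.accept}.Infinite

/-- The `ω`-language of `U`: the infinite words with at least one accepting run. -/
def omegaLanguage (U : NBA A Q) : Set (ℕ → A) :=
  {w | ∃ r, U.IsAcceptingRun w r}

/-- Each infinite word has at most one accepting run. -/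
def IsUnambiguous (U : NBA A Q) : Prop :=
  ∀ w r r', U.IsAcceptingRun w r → U.IsAcceptingRun w r' → r = r'

/-- Every state is reachable from every state along transitions of the automaton. -/
def IsStronglyConnected (U : NBA A Q) : Prop :=
  ∀ p q, Relation.ReflTransGen (fun s t => ∃ a, t ∈ U.step s a) p q

/-- The matrix `M` with `M p q = |{a : q ∈ δ(p, a)}| / |A|`. -/
noncomputable def transitionMatrix [Fintype A] (U : NBA A Q) : Matrix Q Q ℝ :=
  Matrix.of fun p q => ({a | q ∈ U.step p a}.ncard : ℝ) / (Fintype.card A : ℝ)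

end NBA

/-- The uniform probability measure on infinite words: letters are independent and uniformly
distributed, so the cylinder set of a word of length `n` has measure `1 / |A| ^ n`. -/
noncomputable def uniformWordMeasure (A : Type*) [Fintype A] [Nonempty A] [MeasurableSpace A] :
    Measure (ℕ → A) :=
  Measure.infinitePi fun _ : ℕ => (PMF.uniformOfFintype A).toMeasure

/-- The spectral radius of a real square matrix: the largest modulus of its complex eigenvalues. -/
noncomputable def realMatrixSpectralRadius {Q : Type*} [Fintype Q] [DecidableEq Q]
    (M : Matrix Q Q ℝ) : ENNReal :=
  spectralRadius ℂ (M.map Complex.ofReal)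

/-! Two paths with the same label and end points could be prolonged by one accepting run and
preceded by one path from an initial state, so unambiguity excludes them
(`IsUnambiguous.isDiamondFree`). Hence the entry `p q` of `M ^ n` is the probability that a random
prefix of length `n` leads from `p` to `q` (`IsDiamondFree.real_reach`). Powers of `M` thus have
entries at most 1, which gives ρ ≤ 1.

If ρ = 1, the moduli of an eigenvector form a subinvariant vector `x ≤ M x`. Bounded powers and
irreducibility make it invariant and positive, which bounds the probability of having a path of
length `n` from `p` below by `x p / ∑ x`. By König's lemma, infinite runs from `p` exist with
positive probability. Almost all such words are accepted: the probabilities of running forever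
without entering accepting states are subinvariant for a matrix below `M` with a zero column, so
they vanish.

Conversely, if the language has positive measure, the probabilities of having an infinite run form a
nonzero subinvariant vector, and Gelfand's formula gives ρ ≥ 1. -/

theorem exists_pos_of_nonneg_of_ne_zero {Q : Type*} {x : Q → ℝ} (hx : 0 ≤ x) (hx0 : x ≠ 0) :
    ∃ p, 0 < x p := by
  obtain ⟨p, hp⟩ := Function.ne_iff.1 hx0
  exact ⟨p, lt_of_le_of_ne (hx p) (Ne.symm hp)⟩

/-! ### Subinvariant vectors of nonnegative matrices -/

section NonnegMatrix

open Filter Topology Matrix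

variable {Q : Type*} [Fintype Q]

theorem Matrix.mulVec_mono_of_nonneg {M : Matrix Q Q ℝ} (hM : ∀ p q, 0 ≤ M p q) {x y : Q → ℝ}
    (hxy : x ≤ y) : M *ᵥ x ≤ M *ᵥ y := fun p =>
  Finset.sum_le_sum fun q _ => mul_le_mul_of_nonneg_left (hxy q) (hM p q)

variable [DecidableEq Q]

theorem Matrix.pow_nonneg_entries {M : Matrix Q Q ℝ} (hM : ∀ p q, 0 ≤ M p q) (n : ℕ) (p q : Q) :
    0 ≤ (M ^ n) p q := by
  induction n generalizing p q with
  | zero => rw [pow_zero, Matrix.one_apply]; split_ifs <;> norm_num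
  | succ n ih =>
    rw [pow_succ, Matrix.mul_apply]
    exact Finset.sum_nonneg fun r _ => mul_nonneg (ih p r) (hM r q)

theorem Matrix.mul_le_pow_add_apply {M : Matrix Q Q ℝ} (hM : ∀ p q, 0 ≤ M p q) (m n : ℕ)
    (p r q : Q) : (M ^ m) p r * (M ^ n) r q ≤ (M ^ (m + n)) p q := by
  rw [pow_add, Matrix.mul_apply]
  exact Finset.single_le_sum (f := fun s => (M ^ m) p s * (M ^ n) s q)
    (fun s _ => mul_nonneg (pow_nonneg_entries hM m p s) (pow_nonneg_entries hM n s q))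
    (Finset.mem_univ r)

theorem Matrix.pow_smul_le_pow_mulVec {M : Matrix Q Q ℝ} (hM : ∀ p q, 0 ≤ M p q) {x : Q → ℝ}
    {c : ℝ} (hc : 0 ≤ c) (hx : c • x ≤ M *ᵥ x) (n : ℕ) : c ^ n • x ≤ M ^ n *ᵥ x := by
  induction n with
  | zero => simp
  | succ n ih =>
    calc c ^ (n + 1) • x = c • (c ^ n • x) := by rw [smul_smul, pow_succ']
      _ ≤ c • (M ^ n *ᵥ x) := smul_le_smul_of_nonneg_left ih hc
      _ = M ^ n *ᵥ (c • x) := (Matrix.mulVec_smul _ _ _).symm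
      _ ≤ M ^ n *ᵥ (M *ᵥ x) := mulVec_mono_of_nonneg (pow_nonneg_entries hM n) hx
      _ = M ^ (n + 1) *ᵥ x := by rw [Matrix.mulVec_mulVec, pow_succ]

theorem Matrix.le_pow_mulVec {M : Matrix Q Q ℝ} (hM : ∀ p q, 0 ≤ M p q) {x : Q → ℝ}
    (hx : x ≤ M *ᵥ x) (n : ℕ) : x ≤ M ^ n *ᵥ x := by
  simpa using pow_smul_le_pow_mulVec hM zero_le_one (by simpa using hx) n

/-- The moduli of the entries of an eigenvector. -/
theorem Matrix.exists_nonneg_smul_le_mulVec {M : Matrix Q Q ℝ} (hM : ∀ p q, 0 ≤ M p q) {k : ℂ}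
    (hk : k ∈ spectrum ℂ (M.map Complex.ofReal)) :
    ∃ x : Q → ℝ, 0 ≤ x ∧ x ≠ 0 ∧ ‖k‖ • x ≤ M *ᵥ x := by
  rw [← Matrix.spectrum_toLin', ← Module.End.hasEigenvalue_iff_mem_spectrum] at hk
  obtain ⟨v, hv⟩ := hk.exists_hasEigenvector
  have hv' : (M.map Complex.ofReal) *ᵥ v = k • v := by
    simpa [Matrix.toLin'_apply] using hv.apply_eq_smul
  refine ⟨fun q => ‖v q‖, fun q => norm_nonneg _, fun h => hv.2 ?_, fun p => ?_⟩
  · funext q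
    simpa using congrFun h q
  · have := congrFun hv' p
    calc (‖k‖ • fun q => ‖v q‖) p = ‖(k • v) p‖ := by simp
      _ = ‖∑ q, (M p q : ℂ) * v q‖ := by rw [← this]; rfl
      _ ≤ ∑ q, ‖(M p q : ℂ) * v q‖ := norm_sum_le _ _
      _ = (M *ᵥ fun q => ‖v q‖) p := by
        simp [Matrix.mulVec, dotProduct, abs_of_nonneg (hM _ _)]

theorem Matrix.pow_mulVec_apply_le_sum {M : Matrix Q Q ℝ} (hle : ∀ n p q, (M ^ n) p q ≤ 1)
    {x : Q → ℝ} (hx : 0 ≤ x) (n : ℕ) (p : Q) : (M ^ n *ᵥ x) p ≤ ∑ q, x q :=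
  Finset.sum_le_sum fun q _ => mul_le_of_le_one_left (hx q) (hle n p q)

/-- An eigenvalue of modulus above 1 would make the orbit of its modulus vector grow geometrically,
whereas bounded powers keep it bounded. -/
theorem realMatrixSpectralRadius_le_one {M : Matrix Q Q ℝ} (hM : ∀ p q, 0 ≤ M p q)
    (hle : ∀ n p q, (M ^ n) p q ≤ 1) : realMatrixSpectralRadius M ≤ 1 := by
  refine iSup₂_le fun k hk => ?_
  obtain ⟨x, hx, hx0, hkx⟩ := Matrix.exists_nonneg_smul_le_mulVec hM hk
  obtain ⟨p, hp⟩ := exists_pos_of_nonneg_of_ne_zero hx hx0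
  suffices ‖k‖ ≤ 1 by exact_mod_cast this
  by_contra! h
  obtain ⟨n, hn⟩ := ((tendsto_pow_atTop_atTop_of_one_lt h).eventually_gt_atTop
    ((∑ q, x q) / x p)).exists
  rw [div_lt_iff₀ hp] at hn
  exact absurd ((Matrix.pow_smul_le_pow_mulVec hM (norm_nonneg k) hkx n p).trans
    (Matrix.pow_mulVec_apply_le_sum hle hx n p)) (not_le.2 hn)

open scoped Matrix.Norms.Operator in
theorem exists_le_mulVec_of_realMatrixSpectralRadius_eq_one [Nonempty Q] {M : Matrix Q Q ℝ}
    (hM : ∀ p q, 0 ≤ M p q) (hρ : realMatrixSpectralRadius M = 1) :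
    ∃ x : Q → ℝ, 0 ≤ x ∧ x ≠ 0 ∧ x ≤ M *ᵥ x := by
  obtain ⟨k, hk, hkρ⟩ := spectrum.exists_nnnorm_eq_spectralRadius (M.map Complex.ofReal)
  have hk1 : ‖k‖ = 1 := by
    have : (‖k‖₊ : ENNReal) = 1 := hkρ.trans hρ
    exact congrArg NNReal.toReal (ENNReal.coe_eq_one.1 this)
  simpa [hk1] using Matrix.exists_nonneg_smul_le_mulVec hM hk

open scoped Matrix.Norms.Operator in
-- Subinvariance keeps `‖N ^ n‖` above a positive constant `c`; since `c ^ (1 / n)` tends to 1,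
-- Gelfand's formula concludes.
theorem one_le_realMatrixSpectralRadius_of_le_mulVec {M : Matrix Q Q ℝ} (hM : ∀ p q, 0 ≤ M p q)
    {x : Q → ℝ} (hx : 0 ≤ x) (hx0 : x ≠ 0) (hMx : x ≤ M *ᵥ x) :
    1 ≤ realMatrixSpectralRadius M := by
  obtain ⟨p, hp⟩ := exists_pos_of_nonneg_of_ne_zero hx hx0
  have hS : 0 < ∑ q, x q :=
    hp.trans_le (Finset.single_le_sum (fun q _ => hx q) (Finset.mem_univ p))
  set N := M.map Complex.ofReal
  have hpow (n : ℕ) : N ^ n = (M ^ n).map Complex.ofReal :=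
    (Matrix.map_pow M Complex.ofRealHom n).symm
  have hentry (n : ℕ) (q : Q) : (M ^ n) p q ≤ ‖N ^ n‖ := by
    rw [hpow, Matrix.linfty_opNorm_def]
    have h₁ : ‖((M ^ n) p q : ℂ)‖₊ ≤ ∑ j, ‖((M ^ n).map Complex.ofReal) p j‖₊ :=
      Finset.single_le_sum (f := fun j => ‖((M ^ n).map Complex.ofReal) p j‖₊)
        (fun _ _ => zero_le) (Finset.mem_univ q)
    have h₂ := h₁.trans (Finset.le_sup
      (f := fun i => ∑ j, ‖((M ^ n).map Complex.ofReal) i j‖₊) (Finset.mem_univ p))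
    have h₃ : ‖((M ^ n) p q : ℂ)‖ ≤ _ := NNReal.coe_le_coe.2 h₂
    rw [Complex.norm_real] at h₃
    exact (le_abs_self _).trans h₃
  have hlow (n : ℕ) : x p / ∑ q, x q ≤ ‖N ^ n‖ := by
    rw [div_le_iff₀ hS, Finset.mul_sum]
    exact (Matrix.le_pow_mulVec hM hMx n p).trans
      (Finset.sum_le_sum fun q _ => mul_le_mul_of_nonneg_right (hentry n q) (hx q))
  have hc : 0 < x p / ∑ q, x q := div_pos hp hS
  lift x p / ∑ q, x q to NNReal using hc.le with c
  have hlim := spectrum.pow_nnnorm_pow_one_div_tendsto_nhds_spectralRadius N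
  have hlim' : Tendsto (fun n : ℕ => (c : ENNReal) ^ (1 / n : ℝ)) atTop (𝓝 1) := by
    have h0 : c ≠ 0 := by exact_mod_cast hc.ne'
    have : Tendsto (fun n : ℕ => c ^ (1 / n : ℝ)) atTop (𝓝 (c ^ (0 : ℝ))) :=
      (NNReal.continuousAt_rpow (.inl h0)).tendsto.comp
        (tendsto_const_nhds.prodMk_nhds tendsto_one_div_atTop_nhds_zero_nat)
    rw [NNReal.rpow_zero] at this
    simpa [ENNReal.coe_rpow_of_ne_zero h0] using ENNReal.tendsto_coe.2 this
  refine le_of_tendsto_of_tendsto' hlim' hlim fun n => ?_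
  exact ENNReal.rpow_le_rpow (by exact_mod_cast hlow n) (by positivity)

/-- A subinvariant vector of an irreducible nonnegative matrix with bounded powers is invariant. -/
theorem Matrix.mulVec_eq_of_le_mulVec {M : Matrix Q Q ℝ} (hM : ∀ p q, 0 ≤ M p q)
    (hle : ∀ n p q, (M ^ n) p q ≤ 1) (hirr : ∀ p q, ∃ k, 0 < (M ^ k) p q)
    {x : Q → ℝ} (hx : 0 ≤ x) (hx0 : x ≠ 0) (hMx : x ≤ M *ᵥ x) : M *ᵥ x = x := by
  by_contra hne
  set d : Q → ℝ := M *ᵥ x - x with hd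
  have hd0 : 0 ≤ d := sub_nonneg.2 hMx
  obtain ⟨p, hp⟩ := exists_pos_of_nonneg_of_ne_zero hd0 (sub_ne_zero.2 hne)
  -- The images of the defect `d` telescope, so their partial sums stay bounded.
  have htel (N : ℕ) (q : Q) : ∑ n ∈ Finset.range N, (M ^ n *ᵥ d) q = (M ^ N *ᵥ x) q - x q := by
    have : ∀ n, (M ^ n *ᵥ d) q = (M ^ (n + 1) *ᵥ x) q - (M ^ n *ᵥ x) q := fun n => by
      rw [hd, Matrix.mulVec_sub, Matrix.mulVec_mulVec, ← pow_succ]; rfl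
    simp_rw [this]
    rw [Finset.sum_range_sub (fun n => (M ^ n *ᵥ x) q)]
    simp
  have hsum (q : Q) : Summable fun n => (M ^ n) q p * d p := by
    refine summable_of_sum_range_le (c := ∑ r, x r)
      (fun n => mul_nonneg (pow_nonneg_entries hM n q p) hp.le) fun N => ?_
    calc ∑ n ∈ Finset.range N, (M ^ n) q p * d p
        ≤ ∑ n ∈ Finset.range N, (M ^ n *ᵥ d) q := Finset.sum_le_sum fun n _ =>
          Finset.single_le_sum (f := fun r => (M ^ n) q r * d r)
            (fun r _ => mul_nonneg (pow_nonneg_entries hM n q r) (hd0 r)) (Finset.mem_univ p)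
      _ ≤ ∑ r, x r := by
        rw [htel]
        exact (sub_le_self _ (hx q)).trans (pow_mulVec_apply_le_sum hle hx N q)
  -- A path from `r` to `p` transfers the decay of column `p` to column `r`. Then `M ^ n` tends to
  -- 0, against `x ≤ M ^ n x`.
  have hzero (q r : Q) : Tendsto (fun n => (M ^ n) q r) atTop (𝓝 0) := by
    obtain ⟨k, hk⟩ := hirr r p
    have h₁ := ((hsum q).tendsto_atTop_zero.comp (tendsto_add_atTop_nat k)).mul_const
      ((M ^ k) r p * d p)⁻¹
    rw [zero_mul] at h₁
    refine squeeze_zero (fun n => pow_nonneg_entries hM n q r) (fun n => ?_) h₁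
    rw [← div_eq_mul_inv, le_div_iff₀ (mul_pos hk hp), ← mul_assoc]
    exact mul_le_mul_of_nonneg_right (mul_le_pow_add_apply hM n k q r p) hp.le
  obtain ⟨q, hq⟩ := exists_pos_of_nonneg_of_ne_zero hx hx0
  have hlim : Tendsto (fun n => (M ^ n *ᵥ x) q) atTop (𝓝 (∑ r, 0 * x r)) :=
    tendsto_finsetSum _ fun r _ => (hzero q r).mul_const (x r)
  rw [show ∑ r, 0 * x r = 0 by simp] at hlim
  exact hq.not_ge (ge_of_tendsto' hlim fun n => le_pow_mulVec hM hMx n q)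

theorem Matrix.pos_of_mulVec_eq {M : Matrix Q Q ℝ} (hM : ∀ p q, 0 ≤ M p q)
    (hirr : ∀ p q, ∃ k, 0 < (M ^ k) p q) {x : Q → ℝ} (hx : 0 ≤ x) (hx0 : x ≠ 0)
    (heq : M *ᵥ x = x) (q : Q) : 0 < x q := by
  obtain ⟨p, hp⟩ := exists_pos_of_nonneg_of_ne_zero hx hx0
  have hpow (k : ℕ) : M ^ k *ᵥ x = x := by
    induction k with
    | zero => simp
    | succ k ih => rw [pow_succ, ← Matrix.mulVec_mulVec, heq, ih]
  obtain ⟨k, hk⟩ := hirr q p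
  refine (mul_pos hk hp).trans_le (le_trans ?_ (congrFun (hpow k) q).le)
  exact Finset.single_le_sum (f := fun r => (M ^ k) q r * x r)
    (fun r _ => mul_nonneg (pow_nonneg_entries hM k q r) (hx r)) (Finset.mem_univ p)

/-- A matrix `M' ≤ M` with a zero column has no nonzero subinvariant vector. -/
theorem Matrix.eq_zero_of_le_mulVec_of_column_eq_zero {M M' : Matrix Q Q ℝ}
    (hM : ∀ p q, 0 ≤ M p q) (hle : ∀ n p q, (M ^ n) p q ≤ 1)
    (hirr : ∀ p q, ∃ k, 0 < (M ^ k) p q) (hM' : ∀ p q, M' p q ≤ M p q) {f : Q}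
    (hf : ∀ p, M' p f = 0) {x : Q → ℝ} (hx : 0 ≤ x) (hMx : x ≤ M' *ᵥ x) : x = 0 := by
  by_contra hx0
  have hM'x : M' *ᵥ x ≤ M *ᵥ x := fun p =>
    Finset.sum_le_sum fun q _ => mul_le_mul_of_nonneg_right (hM' p q) (hx q)
  have heq := mulVec_eq_of_le_mulVec hM hle hirr hx hx0 (hMx.trans hM'x)
  obtain ⟨p, hp⟩ := exists_pos_of_nonneg_of_ne_zero hx hx0
  have hpos := pos_of_mulVec_eq hM hirr hx hx0 heq
  -- `M x = x ≤ M' x` with `x` positive leaves no room for `M` to exceed `M'` anywhere.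
  have hcol (p : Q) : M p f = 0 := by
    have h : ∑ q, (M p q - M' p q) * x q ≤ 0 := by
      have h₁ : (M *ᵥ x) p ≤ (M' *ᵥ x) p := by rw [heq]; exact hMx p
      simp_rw [sub_mul, Finset.sum_sub_distrib]
      exact sub_nonpos.2 h₁
    have h₂ := (Finset.single_le_sum (f := fun q => (M p q - M' p q) * x q)
      (fun q _ => mul_nonneg (sub_nonneg.2 (hM' p q)) (hx q)) (Finset.mem_univ f)).trans h
    rw [hf, sub_zero] at h₂
    exact le_antisymm (nonpos_of_mul_nonpos_left h₂ (hpos f)) (hM p f)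
  -- The path from `q` to `f` may be empty; an initial edge makes its length positive, so that it
  -- has to use the zero column.
  have hedge : ∃ q, 0 < M p q := by
    by_contra! h
    have : (M *ᵥ x) p ≤ 0 :=
      Finset.sum_nonpos fun q _ => mul_nonpos_of_nonpos_of_nonneg (h q) (hx q)
    rw [heq] at this
    exact hp.not_ge this
  obtain ⟨q, hq⟩ := hedge
  obtain ⟨k, hk⟩ := hirr q f
  have h₁ := mul_le_pow_add_apply hM 1 k p q f
  rw [pow_one, add_comm, pow_succ, Matrix.mul_apply] at h₁
  simp only [hcol, mul_zero, Finset.sum_const_zero] at h₁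
  exact (mul_pos hq hk).not_ge h₁

end NonnegMatrix

/-! ### The shift on random words -/

section Words

variable {A : Type*}

/-- The infinite word `w` without its first letter. -/
def wordTail (w : ℕ → A) : ℕ → A := fun i => w (i + 1)

/-- The infinite word with first letter `a` and tail `w`. -/
def wordCons (a : A) (w : ℕ → A) : ℕ → A
  | 0 => a
  | i + 1 => w i

@[simp] theorem wordCons_zero (a : A) (w : ℕ → A) : wordCons a w 0 = a := rfl

@[simp] theorem wordCons_succ (a : A) (w : ℕ → A) (i : ℕ) : wordCons a w (i + 1) = w i := rfl

theorem wordTail_iterate_apply (w : ℕ → A) (n i : ℕ) : wordTail^[n] w i = w (i + n) := by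
  induction n generalizing w with
  | zero => rfl
  | succ n ih => rw [Function.iterate_succ_apply, ih]; rfl

variable [MeasurableSpace A]

theorem measurable_wordTail : Measurable (wordTail : (ℕ → A) → ℕ → A) :=
  measurable_pi_lambda _ fun i => measurable_pi_apply (i + 1)

theorem measurable_wordCons : Measurable fun z : A × (ℕ → A) => wordCons z.1 z.2 :=
  measurable_pi_lambda _ fun i => by
    cases i with
    | zero => exact measurable_fst
    | succ i => exact (measurable_pi_apply i).comp measurable_snd

theorem map_wordCons_infinitePi (ν : Measure A) [IsProbabilityMeasure ν] :
    (ν.prod (Measure.infinitePi fun _ : ℕ => ν)).map (fun z => wordCons z.1 z.2) =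
      Measure.infinitePi fun _ : ℕ => ν := by
  classical
  refine Measure.eq_infinitePi _ fun s t ht => ?_
  obtain ⟨N, hN⟩ := s.exists_nat_subset_range
  -- Padding with `Set.univ` turns the cylinder into one over an initial segment without changing
  -- its measure.
  set t' : ℕ → Set A := fun i => if i ∈ s then t i else Set.univ with ht'
  have ht'm (i : ℕ) : MeasurableSet (t' i) := by
    by_cases h : i ∈ s <;> simp [ht', h, ht i]
  have hpre : (fun z : A × (ℕ → A) => wordCons z.1 z.2) ⁻¹' (Set.pi s t) =
      t' 0 ×ˢ Set.pi (Finset.range N) (fun i => t' (i + 1)) := by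
    ext ⟨a, w⟩
    simp only [Set.mem_preimage, Set.mem_pi, Set.mem_prod, Finset.mem_coe, Finset.mem_range]
    constructor
    · intro h
      refine ⟨?_, fun i _ => ?_⟩
      · by_cases h0 : 0 ∈ s
        · simpa [ht', h0] using h 0 h0
        · simp [ht', h0]
      · by_cases hi : i + 1 ∈ s
        · simpa [ht', hi] using h (i + 1) hi
        · simp [ht', hi]
    · rintro ⟨h0, h⟩ i hi
      cases i with
      | zero => simpa [ht', hi] using h0
      | succ i =>
        have := h i (by have := Finset.mem_range.1 (hN hi); omega)
        simpa [ht', hi] using this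
  rw [Measure.map_apply measurable_wordCons (.pi s.countable_toSet fun i _ => ht i), hpre,
    Measure.prod_prod, Measure.infinitePi_pi _ fun i _ => ht'm (i + 1), mul_comm,
    ← Finset.prod_range_succ' (fun i => ν (t' i))]
  symm
  calc ∏ i ∈ s, ν (t i) = ∏ i ∈ s, ν (t' i) :=
        Finset.prod_congr rfl fun i hi => by simp [ht', hi]
    _ = ∏ i ∈ Finset.range (N + 1), ν (t' i) := by
        refine Finset.prod_subset (hN.trans (Finset.range_mono N.le_succ)) fun i _ hi => ?_
        simp [ht', hi]

theorem measurableSet_head_tail [DiscreteMeasurableSpace A] (s : Set A) {E : Set (ℕ → A)}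
    (hE : MeasurableSet E) : MeasurableSet {w : ℕ → A | w 0 ∈ s ∧ wordTail w ∈ E} :=
  (measurable_pi_apply 0 (MeasurableSet.of_discrete (s := s))).inter (measurable_wordTail hE)

variable [Fintype A] [Nonempty A]

instance : IsProbabilityMeasure (uniformWordMeasure A) := by
  unfold uniformWordMeasure
  infer_instance

variable [DiscreteMeasurableSpace A]

/-- The first letter is independent of the tail, and the tail is again uniform. -/
theorem uniformWordMeasure_real_head_tail (s : Set A) {E : Set (ℕ → A)} (hE : MeasurableSet E) :
    (uniformWordMeasure A).real {w | w 0 ∈ s ∧ wordTail w ∈ E} =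
      (s.ncard : ℝ) / (Fintype.card A : ℝ) * (uniformWordMeasure A).real E := by
  classical
  have hm := measurableSet_head_tail s hE
  have h : uniformWordMeasure A {w | w 0 ∈ s ∧ wordTail w ∈ E} =
      (PMF.uniformOfFintype A).toMeasure s * uniformWordMeasure A E := by
    conv_lhs => rw [uniformWordMeasure, ← map_wordCons_infinitePi]
    rw [Measure.map_apply measurable_wordCons hm, ← uniformWordMeasure, ← Measure.prod_prod]
    rfl
  rw [Measure.real, h, ENNReal.toReal_mul, PMF.toMeasure_uniformOfFintype_apply _ .of_discrete,
    ENNReal.toReal_div, ← Nat.card_coe_set_eq, Nat.card_eq_fintype_card]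
  rfl

theorem uniformWordMeasure_real_wordTail_preimage {E : Set (ℕ → A)} (hE : MeasurableSet E) :
    (uniformWordMeasure A).real (wordTail ⁻¹' E) = (uniformWordMeasure A).real E := by
  have h := uniformWordMeasure_real_head_tail (A := A) Set.univ hE
  have hA : (Fintype.card A : ℝ) ≠ 0 := by simp
  rw [Set.ncard_univ, Nat.card_eq_fintype_card, div_self hA, one_mul] at h
  rw [← h]
  simp [Set.preimage]

theorem uniformWordMeasure_real_wordTail_iterate_preimage {E : Set (ℕ → A)}
    (hE : MeasurableSet E) (n : ℕ) :
    (uniformWordMeasure A).real (wordTail^[n] ⁻¹' E) = (uniformWordMeasure A).real E := by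
  induction n with
  | zero => rfl
  | succ n ih =>
    rw [Function.iterate_succ, Set.preimage_comp,
      uniformWordMeasure_real_wordTail_preimage (measurable_wordTail.iterate n hE), ih]

end Words

/-! ### Finite paths, infinite runs and their probabilities -/

namespace NBA

variable {A Q : Type*}

/-- The prefix of `w` of length `n` labels a path from the state `p` to the state `q`. -/
def Reach (U : NBA A Q) : ℕ → (ℕ → A) → Q → Q → Prop
  | 0, _, p, q => p = q
  | n + 1, w, p, q => ∃ r ∈ U.step p (w 0), U.Reach n (wordTail w) r q

/-- The infinite words all of whose prefixes label a path from `p`. -/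
def live (U : NBA A Q) (p : Q) : Set (ℕ → A) :=
  {w | ∀ n, ∃ q, U.Reach n w p q}

variable {U : NBA A Q}

theorem exists_reach_of_le {m n : ℕ} (hmn : m ≤ n) {w : ℕ → A} {p q : Q} (h : U.Reach n w p q) :
    ∃ q', U.Reach m w p q' := by
  induction m generalizing n w p with
  | zero => exact ⟨p, rfl⟩
  | succ m ih =>
    obtain ⟨n, rfl⟩ : ∃ k, n = k + 1 := ⟨n - 1, by omega⟩
    obtain ⟨r, hr, h⟩ := h
    obtain ⟨q', h'⟩ := ih (by omega) h
    exact ⟨q', r, hr, h'⟩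

/-- If every successor failed at some length, the largest of these finitely many lengths would bound
all paths from `p`. -/
theorem exists_step_of_mem_live [Finite Q] {p : Q} {w : ℕ → A} (h : w ∈ U.live p) :
    ∃ r ∈ U.step p (w 0), wordTail w ∈ U.live r := by
  by_contra! hcon
  have hn (r : Q) : ∃ n, r ∈ U.step p (w 0) → ∀ q, ¬ U.Reach n (wordTail w) r q := by
    by_cases hr : r ∈ U.step p (w 0)
    · have := hcon r hr
      simp only [live, Set.mem_ofPred_eq, not_forall, not_exists] at this
      exact this.imp fun n hn _ => hn
    · exact ⟨0, fun h => absurd h hr⟩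
  choose n hn using hn
  obtain ⟨N, hN⟩ := (Set.finite_range n).bddAbove
  obtain ⟨q, r, hr, hq⟩ := h (N + 1)
  obtain ⟨q', hq'⟩ := exists_reach_of_le (hN ⟨r, rfl⟩) hq
  exact hn r hr q' hq'

/-- König's lemma for the runs of an automaton. -/
theorem exists_run_of_mem_live [Finite Q] {p : Q} {w : ℕ → A} (h : w ∈ U.live p) :
    ∃ r : ℕ → Q, r 0 = p ∧ ∀ i, r (i + 1) ∈ U.step (r i) (w i) := by
  choose next hstep hlive using
    fun (x : {x : Q × (ℕ → A) // x.2 ∈ U.live x.1}) => exists_step_of_mem_live x.2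
  let g : {x : Q × (ℕ → A) // x.2 ∈ U.live x.1} → {x : Q × (ℕ → A) // x.2 ∈ U.live x.1} :=
    fun x => ⟨(next x, wordTail x.1.2), hlive x⟩
  have hword (i : ℕ) : (g^[i] ⟨(p, w), h⟩).1.2 = wordTail^[i] w := by
    induction i with
    | zero => rfl
    | succ i ih => rw [Function.iterate_succ_apply', Function.iterate_succ_apply', ← ih]
  refine ⟨fun i => (g^[i] ⟨(p, w), h⟩).1.1, rfl, fun i => ?_⟩
  have := hstep (g^[i] ⟨(p, w), h⟩)
  rw [hword, wordTail_iterate_apply, zero_add] at this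
  simpa only [Function.iterate_succ_apply'] using this

theorem mem_live_of_run {w : ℕ → A} {r : ℕ → Q} (h : ∀ i, r (i + 1) ∈ U.step (r i) (w i)) :
    w ∈ U.live (r 0) := by
  intro n
  refine ⟨r n, ?_⟩
  induction n generalizing w r with
  | zero => rfl
  | succ n ih => exact ⟨r 1, h 0, ih (r := fun i => r (i + 1)) fun i => h (i + 1)⟩

section Measure

variable [MeasurableSpace A] [DiscreteMeasurableSpace A] [Countable Q]

theorem measurableSet_reach (U : NBA A Q) (n : ℕ) (p q : Q) :
    MeasurableSet {w | U.Reach n w p q} := by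
  induction n generalizing p with
  | zero => exact .const (p = q)
  | succ n ih =>
    have : {w | U.Reach (n + 1) w p q} =
        ⋃ r, {w | w 0 ∈ {a | r ∈ U.step p a} ∧ wordTail w ∈ {w | U.Reach n w r q}} := by
      ext w; simp [Reach]
    rw [this]
    exact .iUnion fun r => measurableSet_head_tail _ (ih r)

theorem measurableSet_exists_reach (U : NBA A Q) (n : ℕ) (p : Q) :
    MeasurableSet {w | ∃ q, U.Reach n w p q} := by
  rw [Set.ofPred_exists]
  exact .iUnion fun q => measurableSet_reach U n p q

theorem measurableSet_live (U : NBA A Q) (p : Q) : MeasurableSet (U.live p) := by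
  rw [live, Set.ofPred_forall]
  exact .iInter fun n => measurableSet_exists_reach U n p

end Measure

theorem transitionMatrix_nonneg [Fintype A] (U : NBA A Q) (p q : Q) :
    0 ≤ U.transitionMatrix p q := by
  simp only [transitionMatrix, Matrix.of_apply]; positivity

theorem transitionMatrix_pos [Fintype A] {p q : Q} {a : A} (h : q ∈ U.step p a) :
    0 < U.transitionMatrix p q := by
  have : Nonempty A := ⟨a⟩
  have h₁ : 0 < {a | q ∈ U.step p a}.ncard := (Set.ncard_pos (Set.toFinite _)).2 ⟨a, h⟩
  simp only [transitionMatrix, Matrix.of_apply]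
  positivity

theorem IsStronglyConnected.exists_pow_pos [Fintype A] [Fintype Q] [DecidableEq Q]
    (hU : U.IsStronglyConnected) (p q : Q) : ∃ k, 0 < (U.transitionMatrix ^ k) p q := by
  induction hU p q using Relation.ReflTransGen.head_induction_on with
  | refl => exact ⟨0, by simp⟩
  | head h _ ih =>
    obtain ⟨a, h⟩ := h
    obtain ⟨k, hk⟩ := ih
    refine ⟨1 + k, (mul_pos ?_ hk).trans_le
      (Matrix.mul_le_pow_add_apply U.transitionMatrix_nonneg 1 k _ _ _)⟩
    rw [pow_one]
    exact transitionMatrix_pos h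

section Measure

variable [Fintype A] [Nonempty A] [MeasurableSpace A] [DiscreteMeasurableSpace A] [Fintype Q]

theorem real_live_le_mulVec (U : NBA A Q) :
    (fun p => (uniformWordMeasure A).real (U.live p)) ≤
      U.transitionMatrix.mulVec fun p => (uniformWordMeasure A).real (U.live p) := by
  intro p
  calc (uniformWordMeasure A).real (U.live p)
      ≤ (uniformWordMeasure A).real
          (⋃ q, {w | w 0 ∈ {a | q ∈ U.step p a} ∧ wordTail w ∈ U.live q}) :=
        measureReal_mono fun w hw => by simpa using exists_step_of_mem_live hw
    _ ≤ ∑ q, (uniformWordMeasure A).real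
          {w | w 0 ∈ {a | q ∈ U.step p a} ∧ wordTail w ∈ U.live q} :=
        measureReal_iUnion_fintype_le _
    _ = _ := Finset.sum_congr rfl fun q _ =>
        uniformWordMeasure_real_head_tail _ (measurableSet_live U q)

/-- No word can be read along two different paths with the same end points. -/
def IsDiamondFree (U : NBA A Q) : Prop :=
  ∀ n w p q r r', r ∈ U.step p (w 0) → r' ∈ U.step p (w 0) →
    U.Reach n (wordTail w) r q → U.Reach n (wordTail w) r' q → r = r'

/-- Diamond-freeness makes the events for different first steps disjoint, so the union bound becomes
the recursion for matrix powers. -/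
theorem IsDiamondFree.real_reach [DecidableEq Q] (hU : U.IsDiamondFree) (n : ℕ) (p q : Q) :
    (uniformWordMeasure A).real {w | U.Reach n w p q} = (U.transitionMatrix ^ n) p q := by
  induction n generalizing p with
  | zero => by_cases h : p = q <;> simp [Reach, h]
  | succ n ih =>
    have : {w | U.Reach (n + 1) w p q} =
        ⋃ r, {w | w 0 ∈ {a | r ∈ U.step p a} ∧ wordTail w ∈ {w | U.Reach n w r q}} := by
      ext w; simp [Reach]
    rw [this, measureReal_iUnion_fintype]
    · rw [pow_succ', Matrix.mul_apply]
      refine Finset.sum_congr rfl fun r _ => ?_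
      rw [uniformWordMeasure_real_head_tail _ (measurableSet_reach U n r q), ih]
      rfl
    · intro r r' hne
      refine Set.disjoint_left.2 fun w hw hw' => hne (hU n w p q r r' hw.1 hw'.1 hw.2 hw'.2)
    · exact fun r => measurableSet_head_tail _ (measurableSet_reach U n r q)

/-- Continuity from above along the decreasing events. -/
theorem le_real_live {p : Q} {c : ℝ}
    (h : ∀ n, c ≤ (uniformWordMeasure A).real {w | ∃ q, U.Reach n w p q}) :
    c ≤ (uniformWordMeasure A).real (U.live p) := by
  have hanti : Antitone fun n => {w | ∃ q, U.Reach n w p q} :=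
    fun m n hmn w ⟨q, hq⟩ => exists_reach_of_le hmn hq
  have hlim := tendsto_measure_iInter_atTop (μ := uniformWordMeasure A)
    (fun n => (measurableSet_exists_reach U n p).nullMeasurableSet) hanti
    ⟨0, measure_ne_top _ _⟩
  rw [← Set.ofPred_forall] at hlim
  exact ge_of_tendsto' ((ENNReal.tendsto_toReal (measure_ne_top _ _)).comp hlim) h

end Measure

end NBA

/-! ### Unambiguity, acceptance and the zero-one argument -/

namespace NBA

variable {A Q : Type*} {U : NBA A Q}

/-- `r` is an accepting run for `w` that starts in the state `p`. -/
def IsAcceptingRunFrom (U : NBA A Q) (p : Q) (w : ℕ → A) (r : ℕ → Q) : Prop :=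
  r 0 = p ∧ (∀ i, r (i + 1) ∈ U.step (r i) (w i)) ∧ {i | r i ∈ U.accept}.Infinite

theorem IsAcceptingRunFrom.cons {p q : Q} {a : A} {w : ℕ → A} {r : ℕ → Q}
    (h : U.IsAcceptingRunFrom q w r) (hq : q ∈ U.step p a) :
    U.IsAcceptingRunFrom p (wordCons a w) (wordCons p r) := by
  refine ⟨rfl, fun i => ?_, ?_⟩
  · cases i with
    | zero => simpa [h.1] using hq
    | succ i => exact h.2.1 i
  · refine (h.2.2.image Nat.succ_injective.injOn).mono ?_
    rintro _ ⟨i, hi, rfl⟩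
    exact hi

/-- In a strongly connected unambiguous automaton, accepting runs are determined by the word and
the first state, whether initial or not. -/
theorem IsUnambiguous.acceptingRunFrom_unique (hunamb : U.IsUnambiguous)
    (hconn : U.IsStronglyConnected) (hstart : U.start.Nonempty) {p : Q} {w : ℕ → A}
    {r r' : ℕ → Q} (h : U.IsAcceptingRunFrom p w r) (h' : U.IsAcceptingRunFrom p w r') :
    r = r' := by
  obtain ⟨p₀, hp₀⟩ := hstart
  induction hconn p₀ p generalizing w r r' with
  | refl =>
    exact hunamb w r r' ⟨⟨h.1 ▸ hp₀, h.2.1⟩, h.2.2⟩ ⟨⟨h'.1 ▸ hp₀, h'.2.1⟩, h'.2.2⟩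
  | tail _ hstep ih =>
    -- Prepending one edge gives two accepting runs for the same word from the preceding state.
    obtain ⟨a, ha⟩ := hstep
    exact congrArg wordTail (ih (h.cons ha) (h'.cons ha))

theorem exists_reach_of_reflTransGen [Nonempty A] {p q : Q}
    (h : Relation.ReflTransGen (fun s t => ∃ a, t ∈ U.step s a) p q) :
    ∃ n w, U.Reach n w p q := by
  induction h using Relation.ReflTransGen.head_induction_on with
  | refl => exact ⟨0, fun _ => Classical.arbitrary A, rfl⟩
  | head h _ ih =>
    obtain ⟨a, ha⟩ := h
    obtain ⟨n, w, hw⟩ := ih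
    exact ⟨n + 1, wordCons a w, _, ha, hw⟩

/-- The given transition rules out a single state without edges, which is strongly connected too.
Nonempty paths are needed to visit accepting states again and again. -/
theorem IsStronglyConnected.exists_reach_accept (hconn : U.IsStronglyConnected)
    (haccept : U.accept.Nonempty) {p₀ r₀ : Q} {a₀ : A} (h₀ : r₀ ∈ U.step p₀ a₀) (q : Q) :
    ∃ n w, ∃ f ∈ U.accept, U.Reach (n + 1) w q f := by
  have : Nonempty A := ⟨a₀⟩
  obtain ⟨f, hf⟩ := haccept
  have hedge : ∃ a r, r ∈ U.step q a := by
    rcases (hconn q p₀).cases_head with rfl | ⟨r, ⟨a, ha⟩, _⟩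
    · exact ⟨a₀, r₀, h₀⟩
    · exact ⟨a, r, ha⟩
  obtain ⟨a, r, hr⟩ := hedge
  obtain ⟨n, w, hw⟩ := exists_reach_of_reflTransGen (hconn r f)
  exact ⟨n, wordCons a w, f, hf, r, hr, hw⟩

/-- The run that always moves closer to an accepting state is accepting. -/
theorem IsStronglyConnected.exists_isAcceptingRunFrom (hconn : U.IsStronglyConnected)
    (haccept : U.accept.Nonempty) {p₀ r₀ : Q} {a₀ : A} (h₀ : r₀ ∈ U.step p₀ a₀) (q : Q) :
    ∃ w r, U.IsAcceptingRunFrom q w r := by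
  classical
  have hex := hconn.exists_reach_accept haccept h₀
  -- One less than the length of a shortest nonempty path to an accepting state.
  let d (q : Q) : ℕ := Nat.find (hex q)
  have hnext (q : Q) : ∃ a r, r ∈ U.step q a ∧ (r ∈ U.accept ∨ d r < d q) := by
    obtain ⟨w, f, hf, r, hr, hreach⟩ := Nat.find_spec (hex q)
    refine ⟨w 0, r, hr, ?_⟩
    rcases hd : Nat.find (hex q) with _ | n
    · rw [hd] at hreach
      exact .inl ((show r = f from hreach) ▸ hf)
    · rw [hd] at hreach
      refine .inr (lt_of_le_of_lt (Nat.find_min' (hex r) ⟨_, f, hf, hreach⟩) ?_)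
      simp only [d, hd]
      exact Nat.lt_succ_self n
  choose a next hstep hd using hnext
  have hvisit (q : Q) : ∃ i, next^[i + 1] q ∈ U.accept := by
    induction hn : d q using Nat.strong_induction_on generalizing q with
    | _ n ih =>
      rcases hd q with h | h
      · exact ⟨0, h⟩
      · obtain ⟨i, hi⟩ := ih _ (hn ▸ h) (next q) rfl
        exact ⟨i + 1, hi⟩
  refine ⟨fun i => a (next^[i] q), fun i => next^[i] q, rfl, fun i => ?_, ?_⟩
  · simpa only [Function.iterate_succ_apply'] using hstep (next^[i] q)
  · refine Set.infinite_of_forall_exists_gt fun m => ?_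
    obtain ⟨i, hi⟩ := hvisit (next^[m] q)
    refine ⟨i + 1 + m, ?_, by omega⟩
    rwa [← Function.iterate_add_apply] at hi

/-- The word `v` is the prefix of `w` followed by `w'`. It does not depend on `p`, so both branches
of a diamond extend over one word. -/
theorem Reach.exists_isAcceptingRunFrom {n : ℕ} {q : Q} {w w' : ℕ → A} {r : ℕ → Q}
    (hr : U.IsAcceptingRunFrom q w' r) :
    ∃ v : ℕ → A, ∀ p, U.Reach n w p q → ∃ s, U.IsAcceptingRunFrom p v s := by
  induction n generalizing w with
  | zero => exact ⟨w', fun p hp => ⟨r, (show p = q from hp) ▸ hr⟩⟩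
  | succ n ih =>
    obtain ⟨v, hv⟩ := ih (w := wordTail w)
    refine ⟨wordCons (w 0) v, fun p ⟨p', hp', h⟩ => ?_⟩
    obtain ⟨s, hs⟩ := hv p' h
    exact ⟨_, hs.cons hp'⟩

theorem IsUnambiguous.isDiamondFree (hunamb : U.IsUnambiguous)
    (hconn : U.IsStronglyConnected) (hstart : U.start.Nonempty) (haccept : U.accept.Nonempty) :
    U.IsDiamondFree := by
  intro n w p q r r' hr hr' h h'
  obtain ⟨w₁, s₁, hs₁⟩ := hconn.exists_isAcceptingRunFrom haccept hr q
  obtain ⟨v, hv⟩ := Reach.exists_isAcceptingRunFrom (n := n) (w := wordTail w) hs₁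
  obtain ⟨s, hs⟩ := hv r h
  obtain ⟨s', hs'⟩ := hv r' h'
  have heq := hunamb.acceptingRunFrom_unique hconn hstart (hs.cons hr) (hs'.cons hr')
  rw [← hs.1, ← hs'.1]
  exact congrFun heq 1

/-- The automaton without its transitions into accepting states. -/
def avoidAccept (U : NBA A Q) : NBA A Q where
  step p a := U.step p a \ U.accept
  start := U.start
  accept := U.accept

theorem exists_wordTail_iterate_mem_live_avoidAccept {w : ℕ → A} {r : ℕ → Q}
    (hr : ∀ i, r (i + 1) ∈ U.step (r i) (w i)) (hfin : ¬ {i | r i ∈ U.accept}.Infinite) :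
    ∃ k q, wordTail^[k] w ∈ U.avoidAccept.live q := by
  obtain ⟨k, hk⟩ := (Set.not_infinite.1 hfin).bddAbove
  -- The state at time `k` may be accepting; only later entries into accepting states are excluded.
  refine ⟨k, _, mem_live_of_run (r := fun i => r (i + k)) fun i => ⟨?_, fun h => ?_⟩⟩
  · rw [wordTail_iterate_apply, Nat.add_right_comm]
    exact hr (i + k)
  · have : i + 1 + k ≤ k := hk h
    omega

variable [Fintype A] [MeasurableSpace A] [DiscreteMeasurableSpace A] [Fintype Q] [DecidableEq Q]

theorem IsDiamondFree.pow_apply_le_one [Nonempty A] (hU : U.IsDiamondFree) (n : ℕ) (p q : Q) :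
    (U.transitionMatrix ^ n) p q ≤ 1 :=
  (hU.real_reach n p q).symm.trans_le measureReal_le_one

theorem IsDiamondFree.real_live_avoidAccept [Nonempty A] (hU : U.IsDiamondFree)
    (hconn : U.IsStronglyConnected) (haccept : U.accept.Nonempty) (q : Q) :
    (uniformWordMeasure A).real (U.avoidAccept.live q) = 0 := by
  obtain ⟨f, hf⟩ := haccept
  refine congrFun (Matrix.eq_zero_of_le_mulVec_of_column_eq_zero U.transitionMatrix_nonneg
    hU.pow_apply_le_one hconn.exists_pow_pos (M' := U.avoidAccept.transitionMatrix) (f := f)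
    (fun p q => ?_) (fun p => ?_) (fun _ => measureReal_nonneg)
    (real_live_le_mulVec U.avoidAccept)) q
  · simp only [transitionMatrix, Matrix.of_apply]
    refine div_le_div_of_nonneg_right (Nat.cast_le.2 ?_) (Nat.cast_nonneg _)
    exact Set.ncard_le_ncard (fun a h => h.1) (Set.toFinite _)
  · simp [transitionMatrix, avoidAccept, hf]

/-- Almost every word with an infinite run from an initial state is accepted. -/
theorem IsDiamondFree.measure_live_le_omegaLanguage [Nonempty A] (hU : U.IsDiamondFree)
    (hconn : U.IsStronglyConnected) (haccept : U.accept.Nonempty) {p : Q} (hp : p ∈ U.start) :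
    uniformWordMeasure A (U.live p) ≤ uniformWordMeasure A U.omegaLanguage := by
  refine measure_mono_ae ?_
  -- Shift invariance makes each of these countably many exceptional events null.
  have hnull (k : ℕ) (q : Q) :
      ∀ᵐ w ∂uniformWordMeasure A, wordTail^[k] w ∉ U.avoidAccept.live q := by
    have h : uniformWordMeasure A (wordTail^[k] ⁻¹' U.avoidAccept.live q) = 0 := by
      rw [← measureReal_eq_zero_iff, uniformWordMeasure_real_wordTail_iterate_preimage
        (measurableSet_live _ q), hU.real_live_avoidAccept hconn haccept]
    exact measure_eq_zero_iff_ae_notMem.1 h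
  filter_upwards [ae_all_iff.2 fun k => ae_all_iff.2 (hnull k)] with w hw hwp
  obtain ⟨r, hr0, hr⟩ := exists_run_of_mem_live hwp
  refine ⟨r, ⟨hr0 ▸ hp, hr⟩, ?_⟩
  by_contra hfin
  obtain ⟨k, q, hkq⟩ := exists_wordTail_iterate_mem_live_avoidAccept hr hfin
  exact hw k q hkq

theorem IsDiamondFree.real_live_pos [Nonempty A] (hU : U.IsDiamondFree)
    (hconn : U.IsStronglyConnected) (hρ : realMatrixSpectralRadius U.transitionMatrix = 1)
    (p : Q) : 0 < (uniformWordMeasure A).real (U.live p) := by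
  have : Nonempty Q := ⟨p⟩
  have hM := U.transitionMatrix_nonneg
  obtain ⟨x, hx, hx0, hMx⟩ := exists_le_mulVec_of_realMatrixSpectralRadius_eq_one hM hρ
  have heq := Matrix.mulVec_eq_of_le_mulVec hM hU.pow_apply_le_one hconn.exists_pow_pos hx hx0 hMx
  have hpos := Matrix.pos_of_mulVec_eq hM hconn.exists_pow_pos hx hx0 heq p
  have hS : 0 < ∑ q, x q :=
    hpos.trans_le (Finset.single_le_sum (fun q _ => hx q) (Finset.mem_univ p))
  refine (div_pos hpos hS).trans_le (le_real_live fun n => ?_)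
  rw [div_le_iff₀ hS, Finset.mul_sum]
  refine (Matrix.le_pow_mulVec hM hMx n p).trans
    (Finset.sum_le_sum fun q _ => mul_le_mul_of_nonneg_right ?_ (hx q))
  refine (hU.real_reach n p q).symm.trans_le ?_
  exact measureReal_mono fun w hw => ⟨q, hw⟩

theorem one_le_realMatrixSpectralRadius_of_omegaLanguage_pos [Nonempty A]
    (h : 0 < uniformWordMeasure A U.omegaLanguage) :
    1 ≤ realMatrixSpectralRadius U.transitionMatrix := by
  refine one_le_realMatrixSpectralRadius_of_le_mulVec U.transitionMatrix_nonneg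
    (fun _ => measureReal_nonneg) (fun h0 => h.ne' ?_) (real_live_le_mulVec U)
  -- If all live sets were null, so would be the language, which their union contains.
  refine measure_mono_null (t := ⋃ p, U.live p) ?_ (measure_iUnion_null fun p => ?_)
  · rintro w ⟨r, hr, _⟩
    exact Set.mem_iUnion.2 ⟨r 0, mem_live_of_run hr.2⟩
  · exact (measureReal_eq_zero_iff).1 (congrFun h0 p)

end NBA

theorem mainTheorem3 {A Q : Type*} [Fintype A] [Nontrivial A]
    [MeasurableSpace A] [DiscreteMeasurableSpace A] [Fintype Q] [DecidableEq Q]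
    (U : NBA A Q) (hconn : U.IsStronglyConnected) (hunamb : U.IsUnambiguous)
    (hstart : U.start.Nonempty) (haccept : U.accept.Nonempty) :
    realMatrixSpectralRadius U.transitionMatrix ≤ 1 ∧
      (realMatrixSpectralRadius U.transitionMatrix = 1 ↔
        0 < uniformWordMeasure A U.omegaLanguage) := by
  have hU := hunamb.isDiamondFree hconn hstart haccept
  have hle : realMatrixSpectralRadius U.transitionMatrix ≤ 1 :=
    realMatrixSpectralRadius_le_one U.transitionMatrix_nonneg hU.pow_apply_le_one
  refine ⟨hle, fun hρ => ?_, fun h =>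
    hle.antisymm (NBA.one_le_realMatrixSpectralRadius_of_omegaLanguage_pos h)⟩
  obtain ⟨p, hp⟩ := hstart
  have h₁ : 0 < uniformWordMeasure A (U.live p) :=
    (ENNReal.toReal_pos_iff.1 (hU.real_live_pos hconn hρ p)).1
  exact h₁.trans_le (hU.measure_live_le_omegaLanguage hconn haccept hp)
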